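/- Let $K$ be a field of characteristic zero, let $a,b\in K$ with $b\neq 0$, put $\zeta(z)=e^{z/2}-e^{-z/2}$, and for $\rho\in K$ and $m\in\mathbb{Z}$ let $$J_m(\rho)=\mathcal{P}_m^{(\rho b-m-1,\,1)}(1-2a),$$ where for $n\ge 0$ the Jacobi polynomials are $$\mathcal{P}_n^{(\alpha,\beta)}(z)=\frac{\Gamma(\alpha+n+1)}{\Gamma(\alpha+1)\,\Gamma(n+1)}\;{}_2F_1\!\left(-n,\,1+\alpha+\beta+n;\,\alpha+1;\,\tfrac{1-z}{2}\right)=\frac1{n!}\sum_{s=0}^n \frac{(-n)_s\,(1+\alpha+\beta+n)_s\,(\alpha+s+1)_{n-s}}{s!}\left(\tfrac{1-z}{2}\right)^s,$$ with $(x)_s=x(x+1)\cdots(x+s-1)$ (the right-hand side being the definition for all $\alpha,\beta,z\in K$), and $\mathcal{P}_n^{(\alpha,\beta)}=0$ for $n<0$. Consider the formal series in $w$, with coefficients that are formal Laurent series in $u$ over $K$, $$\Xi_\rho(u,w)=\exp\left(\sum_{i=1}^\infty \frac{a^i-1}{i}\,w^i\,\frac{\zeta(iu\rho)}{\zeta(iub^{-1})}\right).$$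 Then: 1. For every integer $k\ge 0$ there exist polynomials $G_k^1(\rho,m)$ and $G_k^2(\rho,m)$ in two variables with coefficients in $K$ (depending only on $k$, $a$, $b$), each of total degree at most $9k+2$, such that for all integers $m\ge 1$ and all $\rho\in K$ $$[u^{2k}w^m]\,\Xi_\rho(u,w)=(-1)^m\,\frac{\rho}{m}\Big(G_k^1(\rho,m)\,J_{m-1}(\rho)+G_k^2(\rho,m)\,J_{m-2}(\rho)\Big).$$ 2. For all $\rho\in K$ and all integers $m\ge 0$, the coefficient $[w^m]\,\Xi_\rho(u,w)$ contains no negative powers of $u$ and no odd powers of $u$. -/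

import Mathlib

open scoped LaurentSeries PowerSeries

noncomputable section

namespace TorusKnot

variable {K : Type*} [Field K]

/-- The Pochhammer symbol (rising factorial) `(x)_n = x (x + 1) ⋯ (x + n - 1)`, with `(x)_0 = 1`. -/
def poch (x : K) (n : ℕ) : K := (ascPochhammer K n).eval x

/-- The Jacobi polynomial `P_n^{(α, β)}(z)` for `n ≥ 0`, i.e.
`Γ(α + n + 1) / (Γ(α + 1) Γ(n + 1)) * ₂F₁(-n, 1 + α + β + n; α + 1; (1 - z) / 2)`.
The hypergeometric series stops at `s = n`, and the Gamma factors are combined with the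
denominator `(α + 1)_s` into `(α + s + 1)_{n - s}`, which makes sense for every `α`
(see `jacobi_eq_hypergeometric`). -/
def jacobi (n : ℕ) (α β z : K) : K :=
  ∑ s ∈ Finset.range (n + 1),
    poch (α + s + 1) (n - s) / (n.factorial : K) *
      (poch (-(n : K)) s * poch (1 + α + β + n) s / (s.factorial : K)) * ((1 - z) / 2) ^ s

/-- Away from the removable singularities in `α`, `jacobi` is the hypergeometric expression,
with prefactor `Γ(α + n + 1) / (Γ(α + 1) Γ(n + 1)) = (α + 1)_n / n!`. -/
theorem jacobi_eq_hypergeometric (n : ℕ) (α β z : K) (h : poch (α + 1) n ≠ 0) :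
    jacobi n α β z = poch (α + 1) n / (n.factorial : K) *
      ∑ s ∈ Finset.range (n + 1), poch (-(n : K)) s * poch (1 + α + β + n) s /
        (poch (α + 1) s * (s.factorial : K)) * ((1 - z) / 2) ^ s := by
  unfold jacobi
  rw [Finset.mul_sum]
  refine Finset.sum_congr rfl fun s hs => ?_
  have hsn : s ≤ n := Nat.lt_succ_iff.mp (Finset.mem_range.mp hs)
  have key : poch (α + 1) n = poch (α + 1) s * poch (α + s + 1) (n - s) := by
    have h1 := congrArg (Polynomial.eval (α + 1)) (ascPochhammer_mul K s (n - s))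
    rw [Nat.add_sub_cancel' hsn] at h1
    simp only [Polynomial.eval_mul, Polynomial.eval_comp, Polynomial.eval_add,
      Polynomial.eval_X, Polynomial.eval_natCast] at h1
    unfold poch
    rw [← h1, show α + 1 + (s : K) = α + s + 1 by ring]
  have hs0 : poch (α + 1) s ≠ 0 := fun h0 => h (by rw [key, h0, zero_mul])
  rw [key]
  field_simp

/-- The Jacobi polynomial with integer degree: for negative degree the factor `1 / Γ(n + 1)`
vanishes, and the polynomial is zero. -/
def jacobiZ (n : ℤ) (α β z : K) : K :=
  if 0 ≤ n then jacobi n.toNat α β z else 0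

/-- `J_n(ρ) = P_n^{(ρ b - n - 1, 1)}(1 - 2 a)`. -/
def specJacobi (a b ρ : K) (n : ℤ) : K :=
  jacobiZ n (ρ * b - n - 1) 1 (1 - 2 * a)

/-- `ζ(c u) = e^{c u / 2} - e^{-c u / 2}` as a formal power series in `u`. -/
def zetaSeries [CharZero K] (c : K) : K⟦X⟧ :=
  PowerSeries.rescale (c / 2) (PowerSeries.exp K) -
    PowerSeries.rescale (-(c / 2)) (PowerSeries.exp K)

/-- The quotient `ζ(i u ρ) / ζ(i u b⁻¹)`, taken in the field of Laurent series in `u`. -/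
def zetaRatio [CharZero K] (b ρ : K) (i : ℕ) : K⸨X⸩ :=
  (zetaSeries (i * ρ) : K⸨X⸩) / (zetaSeries (i * b⁻¹) : K⸨X⸩)

/-- The series `∑_{i ≥ 1} (a^i - 1) / i * w^i * ζ(i u ρ) / ζ(i u b⁻¹)`, as a formal power series
in `w` whose coefficients are Laurent series in `u`. -/
def exponent [CharZero K] (a b ρ : K) : PowerSeries (K⸨X⸩) :=
  PowerSeries.mk fun i => if i = 0 then 0 else ((a ^ i - 1) / (i : K)) • zetaRatio b ρ i

/-- The exponential of `exponent a b ρ` as a formal power series in `w`: the series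
`∑ Xⁿ / n!`, with `exponent a b ρ` (which has zero constant term) substituted for `X`. -/
def expSeries [CharZero K] (a b ρ : K) : PowerSeries (K⸨X⸩) :=
  PowerSeries.subst (exponent a b ρ)
    (PowerSeries.map (HahnSeries.C : K →+* K⸨X⸩) (PowerSeries.exp K))

/-- `[u^n w^m] exp(∑_{i ≥ 1} (a^i - 1) / i * w^i * ζ(i u ρ) / ζ(i u b⁻¹))`. -/
def expCoeff [CharZero K] (a b ρ : K) (n : ℤ) (m : ℕ) : K :=
  HahnSeries.coeff (PowerSeries.coeff m (expSeries a b ρ)) n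

end TorusKnot

end

/-!
Write `c = ρ b`. The proof makes the coefficient of `w ^ m` explicit. The exponential of
`∑ w^i / i * ζ(i u ρ) / ζ(i u b⁻¹)` is the `q`-binomial series
`∑_s w^s ∏_{j < s} ζ(u (ρ + j / b)) / ζ(u (j + 1) / b)`: its coefficients satisfy a first-order
recurrence, hence the series satisfies a `q`-difference equation, and taking the logarithmic
derivative of that equation gives `ζ(i u ρ) / ζ(i u b⁻¹)` as the coefficients of `w e' / e`
(`exists_logDeriv_of_qRecurrence`, `exists_logDeriv_qBinomialSeries`). Since `ζ` is odd, the full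
exponential is the product of the series for `(a w, ρ)` and for `(w, -ρ)` (`expSeries_eq`).

With `ζ(x u) = x u S(x u)` for an even series `S` of constant term `1`, the coefficient of `w ^ m`
becomes `∑_{s + r = m} a^s (c)_s / s! (-c)_r / r!` times products of series `S` and `1 / S` in `u`.
These are even power series in `u`, which gives the statement on negative and odd powers of `u`.
The coefficient of `u ^ n` in the products is a polynomial in `ρ`, `s`, `m` of degree at most `2 n`,
by induction on `n`, because every summation over `s` raises the degree by one
(`coeff_qCorrection_mem_polyFun`).

So everything reduces to the moments `∑_s a^s s^j (c)_s / s! (-c)_{m - s} / (m - s)!`. The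
recurrence of these hypergeometric terms expresses the moment with `j + 2` by lower ones, with
coefficients polynomial in `c` and `m` and the constant leading coefficient `1 - a`
(`moment_sPow_add_two`). The moments with `j = 0` and `j = 1` are, up to the factor `ρ / m` and
polynomials, combinations of the coefficients of `w^(m - 1)` and `w^(m - 2)` in
`(1 - a w)^{-c - 1} (1 - w)^{c - 1}`, which are the Jacobi polynomials up to sign
(`specJacobi_natCast`). The reduction fails at `a = 1`, where the exponent vanishes and there is
nothing to prove. The degrees obtained are at most `4 k`, below the required `9 k + 2`.
-/

noncomputable section

namespace TorusKnot

open PowerSeries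

/-! ### First-order recurrences for power series -/

section EulerOperator

variable {R : Type*} [CommRing R]

/-- The Euler operator `w d/dw` on formal power series in `w`. -/
def euler (R : Type*) [CommRing R] : Derivation R R⟦X⟧ R⟦X⟧ :=
  (X : R⟦X⟧) • derivative R

theorem euler_mul (f g : R⟦X⟧) : euler R (f * g) = f * euler R g + g * euler R f := by
  simp [Derivation.leibniz]

theorem coeff_euler (f : R⟦X⟧) (n : ℕ) : coeff n (euler R f) = n * coeff n f := by
  change coeff n (X * derivative R f) = _
  cases n with
  | zero => simp
  | succ n => rw [coeff_succ_X_mul, coeff_derivative]; push_cast; ring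

theorem euler_rescale (r : R) (f : R⟦X⟧) : euler R (rescale r f) = rescale r (euler R f) := by
  ext n
  simp only [coeff_euler, coeff_rescale]
  ring

theorem rescale_C_eq (r x : R) : rescale r (C x : R⟦X⟧) = C x := by
  ext n
  rw [coeff_rescale, coeff_C]
  split_ifs with h <;> simp [h]

theorem euler_map {S : Type*} [CommRing S] (φ : R →+* S) (f : R⟦X⟧) :
    euler S (PowerSeries.map φ f) = PowerSeries.map φ (euler R f) := by
  ext n
  simp [coeff_euler]

/-- A solution of `w f' = g f` with `g(0) = 0` is determined by its constant term. -/
theorem eq_of_euler_eq_mul [IsDomain R] [CharZero R] {f h g : R⟦X⟧}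
    (hg : constantCoeff g = 0) (hf : euler R f = g * f) (hh : euler R h = g * h)
    (h0 : constantCoeff f = constantCoeff h) : f = h := by
  ext n
  induction n using Nat.strong_induction_on with
  | _ n ih =>
    rcases Nat.eq_zero_or_pos n with rfl | hn
    · simpa using h0
    · have h1 := congrArg (coeff n) hf
      have h2 := congrArg (coeff n) hh
      rw [coeff_euler, coeff_mul] at h1 h2
      have hn0 : (n : R) ≠ 0 := by exact_mod_cast hn.ne'
      apply mul_left_cancel₀ hn0
      rw [h1, h2]
      refine Finset.sum_congr rfl fun ij hij => ?_
      rcases Nat.eq_zero_or_pos ij.1 with h | h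
      · rw [h, coeff_zero_eq_constantCoeff_apply, hg]; simp
      · rw [ih ij.2 (by have := Finset.HasAntidiagonal.mem_antidiagonal.mp hij; omega)]

/-- If the coefficients of `e` satisfy the first-order `q`-recurrence equivalent to
`(1 - Q w) e(p w) = (1 - Q' w) e(p' w)`, then the logarithmic derivative `D = w e' / e`
satisfies `D_i (p ^ i - p' ^ i) = Q ^ i - Q' ^ i`. -/
theorem exists_logDeriv_of_qRecurrence {e : R⟦X⟧} (he : constantCoeff e = 1) {p p' Q Q' : R}
    (h : ∀ s, coeff (s + 1) e * (p ^ (s + 1) - p' ^ (s + 1)) =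
      coeff s e * (Q * p ^ s - Q' * p' ^ s)) :
    ∃ D : R⟦X⟧, euler R e = D * e ∧
      ∀ i, coeff i D * (p ^ i - p' ^ i) = Q ^ i - Q' ^ i := by
  have hu : IsUnit e := by rw [PowerSeries.isUnit_iff_constantCoeff, he]; exact isUnit_one
  obtain ⟨v, hv⟩ := hu.exists_left_inv
  refine ⟨euler R e * v, by rw [mul_assoc, hv, mul_one], ?_⟩
  set D := euler R e * v with hD
  have hDe : euler R e = D * e := by rw [hD, mul_assoc, hv, mul_one]
  have hc : ∀ r : R, constantCoeff (rescale r e) = 1 := by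
    intro r
    rw [← coeff_zero_eq_constantCoeff_apply, coeff_rescale]
    simp [he]
  have hfun : (1 - C Q * X) * rescale p e = (1 - C Q' * X) * rescale p' e := by
    ext n
    cases n with
    | zero => simp [hc]
    | succ s =>
      have := h s
      simp only [sub_mul, one_mul, map_sub, coeff_rescale, mul_assoc, coeff_C_mul,
        coeff_succ_X_mul]
      linear_combination this
  have hgeom : ∀ q : R, (1 - C q * X) * mk (fun i => q ^ i) = 1 := by
    intro q
    ext n
    cases n with
    | zero => simp
    | succ s =>
      simp only [sub_mul, one_mul, map_sub, mul_assoc, coeff_C_mul, coeff_succ_X_mul, coeff_mk,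
        coeff_one]
      simp [pow_succ']
  have hθ : ∀ q r : R, euler R ((1 - C q * X) * rescale r e) =
      (rescale r D - C q * X * mk (fun i => q ^ i)) * ((1 - C q * X) * rescale r e) := by
    intro q r
    have h1 : euler R (1 - C q * X : R⟦X⟧) = - (C q * X) := by
      ext n
      rw [coeff_euler]
      rcases n with _ | _ | n <;> simp [coeff_one]
    rw [euler_mul, h1, euler_rescale, hDe, map_mul]
    linear_combination (C q * X * rescale r e) * hgeom q
  have hM : IsUnit ((1 - C Q * X) * rescale p e) := by
    rw [PowerSeries.isUnit_iff_constantCoeff]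
    simp [hc]
  have key : rescale p D - C Q * X * mk (fun i => Q ^ i) =
      rescale p' D - C Q' * X * mk (fun i => Q' ^ i) := by
    apply hM.mul_right_cancel
    rw [← hθ, hfun, hθ]
  intro i
  have hi := congrArg (coeff i) key
  simp only [map_sub, coeff_rescale, mul_assoc, coeff_C_mul] at hi
  cases i with
  | zero => simp
  | succ i =>
    simp only [coeff_succ_X_mul, coeff_mk] at hi
    linear_combination hi

end EulerOperator

/-! ### The q-binomial series -/

section QBinomial

variable {K : Type*} [Field K]

theorem poch_zero (x : K) : poch x 0 = 1 := by simp [poch]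

theorem poch_succ (x : K) (n : ℕ) : poch x (n + 1) = poch x n * (x + n) := by
  simp [poch, ascPochhammer_succ_eval]

theorem poch_succ_left (x : K) (n : ℕ) : poch x (n + 1) = x * poch (x + 1) n := by
  simp [poch, ascPochhammer_succ_left, Polynomial.eval_comp]

variable [CharZero K]

/-- The even power series `sinh (u / 2) / (u / 2) = ζ(u) / u`. -/
def sinhc (K : Type*) [Field K] [CharZero K] : K⟦X⟧ :=
  PowerSeries.mk fun n => coeff (n + 1) (zetaSeries (1 : K))

theorem coeff_zetaSeries (x : K) (n : ℕ) :
    coeff n (zetaSeries x) = x ^ n * ((1 / 2) ^ n - (-(1 / 2)) ^ n) / (n.factorial : K) := by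
  simp only [zetaSeries, map_sub, coeff_rescale, coeff_exp]
  rw [show x / 2 = x * (1 / 2) by ring, show -(x * (1 / 2)) = x * (-(1 / 2)) by ring,
    mul_pow, mul_pow]
  simp
  ring

theorem zetaSeries_eq (x : K) : zetaSeries x = X * (C x * rescale x (sinhc K)) := by
  ext n
  cases n with
  | zero => simp [coeff_zetaSeries]
  | succ n =>
    rw [coeff_succ_X_mul, coeff_C_mul, coeff_rescale, sinhc, coeff_mk, coeff_zetaSeries,
      coeff_zetaSeries]
    ring

theorem constantCoeff_sinhc : constantCoeff (sinhc K) = 1 := by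
  rw [← coeff_zero_eq_constantCoeff_apply, sinhc, coeff_mk, coeff_zetaSeries]
  norm_num

theorem coeff_sinhc_of_odd {n : ℕ} (hn : Odd n) : coeff n (sinhc K) = 0 := by
  rw [sinhc, coeff_mk, coeff_zetaSeries, (hn.add_one).neg_pow]
  simp

theorem zetaSeries_ne_zero {x : K} (hx : x ≠ 0) : zetaSeries x ≠ 0 := by
  intro h
  have h1 := congrArg (coeff 1) h
  rw [zetaSeries_eq, coeff_succ_X_mul] at h1
  simp [constantCoeff_sinhc, hx] at h1

theorem zetaSeries_neg (x : K) : zetaSeries (-x) = -zetaSeries x := by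
  simp [zetaSeries, neg_div]

/-- The correction factor `∏_{j < s} S(u (ρ + j / b)) / S(u (j + 1) / b)`, with
`S(u) = ζ(u) / u`, by which the `q`-binomial coefficient differs from `(ρ b)_s / s!`. -/
def qCorrection (b ρ : K) (s : ℕ) : K⟦X⟧ :=
  ∏ j ∈ Finset.range s,
    rescale (ρ + j * b⁻¹) (sinhc K) * rescale ((j + 1) * b⁻¹) (sinhc K)⁻¹

/-- The series `∑_s w^s ∏_{j < s} ζ(u (ρ + j / b)) / ζ(u (j + 1) / b)`: the exponential of
`∑ w^i / i * ζ(i u ρ) / ζ(i u b⁻¹)`. -/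
def qBinomialSeries (b ρ : K) : K⟦X⟧⟦X⟧ :=
  PowerSeries.mk fun s => C (poch (ρ * b) s / (s.factorial : K)) * qCorrection b ρ s

theorem sinhc_mul_inv : sinhc K * (sinhc K)⁻¹ = 1 :=
  PowerSeries.mul_inv_cancel _ (by simp [constantCoeff_sinhc])

theorem qCorrection_succ_mul (b ρ : K) (s : ℕ) :
    qCorrection b ρ (s + 1) * rescale ((s + 1) * b⁻¹) (sinhc K) =
      qCorrection b ρ s * rescale (ρ + s * b⁻¹) (sinhc K) := by
  have h := congrArg (rescale (((s : K) + 1) * b⁻¹)) (sinhc_mul_inv (K := K))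
  rw [map_mul, map_one] at h
  rw [qCorrection, Finset.prod_range_succ, ← qCorrection]
  linear_combination qCorrection b ρ s * rescale (ρ + s * b⁻¹) (sinhc K) * h

theorem coeff_qBinomialSeries_succ {b : K} (hb : b ≠ 0) (ρ : K) (s : ℕ) :
    coeff (s + 1) (qBinomialSeries b ρ) * zetaSeries ((s + 1) * b⁻¹) =
      coeff s (qBinomialSeries b ρ) * zetaSeries (ρ + s * b⁻¹) := by
  simp only [qBinomialSeries, coeff_mk, zetaSeries_eq]
  have hc : C (poch (ρ * b) (s + 1) / ((s + 1).factorial : K)) * C (((s : K) + 1) * b⁻¹) =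
      C (poch (ρ * b) s / (s.factorial : K)) * C (ρ + s * b⁻¹) := by
    rw [← map_mul, ← map_mul]
    congr 1
    have h1 : ((s : K) + 1) ≠ 0 := by exact_mod_cast Nat.succ_ne_zero s
    have h2 : (s.factorial : K) ≠ 0 := by exact_mod_cast Nat.factorial_ne_zero s
    rw [poch_succ, Nat.factorial_succ]
    push_cast
    field_simp
  linear_combination X * C (poch (ρ * b) (s + 1) / ((s + 1).factorial : K)) *
      C (((s : K) + 1) * b⁻¹) * qCorrection_succ_mul b ρ s +
    X * qCorrection b ρ s * rescale (ρ + s * b⁻¹) (sinhc K) * hc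

theorem constantCoeff_qBinomialSeries (b ρ : K) : constantCoeff (qBinomialSeries b ρ) = 1 := by
  rw [← coeff_zero_eq_constantCoeff_apply, qBinomialSeries, coeff_mk]
  simp [poch_zero, qCorrection]

/-- The `q`-binomial theorem in logarithmic form. -/
theorem exists_logDeriv_qBinomialSeries {b : K} (hb : b ≠ 0) (ρ : K) :
    ∃ D : K⟦X⟧⟦X⟧, euler _ (qBinomialSeries b ρ) = D * qBinomialSeries b ρ ∧
      ∀ i : ℕ, coeff i D * zetaSeries (i * b⁻¹) = zetaSeries (i * ρ) := by
  have hpow : ∀ (x : K) (i : ℕ), rescale x (exp K) ^ i = rescale (i * x) (exp K) := by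
    intro x i
    rw [← map_pow, exp_pow_eq_rescale_exp, rescale_rescale]
  obtain ⟨D, hD, hcoeff⟩ := exists_logDeriv_of_qRecurrence
    (constantCoeff_qBinomialSeries b ρ)
    (p := rescale (b⁻¹ / 2) (exp K)) (p' := rescale (-(b⁻¹ / 2)) (exp K))
    (Q := rescale (ρ / 2) (exp K)) (Q' := rescale (-(ρ / 2)) (exp K)) (by
      intro s
      have h := coeff_qBinomialSeries_succ hb ρ s
      simp only [hpow, exp_mul_exp_eq_exp_add]
      simp only [zetaSeries] at h
      convert h using 4 <;> congr 2 <;> push_cast <;> ring)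
  refine ⟨D, hD, fun i => ?_⟩
  have h := hcoeff i
  simp only [hpow] at h
  simp only [zetaSeries]
  convert h using 4 <;> congr 2 <;> ring

end QBinomial

/-! ### The exponential as a product of q-binomial series -/

section ExpSeries

variable {K : Type*} [Field K] [CharZero K]

theorem constantCoeff_exponent (a b ρ : K) : constantCoeff (exponent a b ρ) = 0 := by
  rw [← coeff_zero_eq_constantCoeff_apply, exponent, coeff_mk, if_pos rfl]

theorem charZero_laurentSeries : CharZero K⸨X⸩ :=
  charZero_of_injective_ringHom (HahnSeries.C_injective (Γ := ℤ) (R := K))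

theorem euler_expSeries (a b ρ : K) :
    euler _ (expSeries a b ρ) = euler _ (exponent a b ρ) * expSeries a b ρ := by
  have hd : derivative K⸨X⸩ (PowerSeries.map (HahnSeries.C : K →+* K⸨X⸩) (exp K)) =
      PowerSeries.map (HahnSeries.C : K →+* K⸨X⸩) (exp K) := by
    ext1 n
    have h := congrArg (fun f => (HahnSeries.C : K →+* K⸨X⸩) (coeff n f)) (derivative_exp K)
    rw [PowerSeries.coeff_map, ← h, coeff_derivative, coeff_derivative, PowerSeries.coeff_map,
      map_mul, map_add, map_natCast, map_one]
  have h := derivative_subst (f := PowerSeries.map (HahnSeries.C : K →+* K⸨X⸩) (exp K))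
    (HasSubst.of_constantCoeff_zero' (constantCoeff_exponent a b ρ))
  rw [hd] at h
  change X * derivative K⸨X⸩ (PowerSeries.subst _ _) =
    X * derivative K⸨X⸩ (exponent a b ρ) * expSeries a b ρ
  rw [h, expSeries]
  ring

theorem constantCoeff_expSeries (a b ρ : K) : constantCoeff (expSeries a b ρ) = 1 := by
  have hs : HasSubst (exponent a b ρ) :=
    HasSubst.of_constantCoeff_zero' (constantCoeff_exponent a b ρ)
  have h := constantCoeff_subst_eq_zero (R := K⸨X⸩) (constantCoeff_exponent a b ρ)
    (PowerSeries.map (HahnSeries.C : K →+* K⸨X⸩) (exp K) - 1) (by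
      rw [map_sub, ← coeff_zero_eq_constantCoeff_apply, PowerSeries.coeff_map]
      simp)
  rw [subst_sub hs, ← coe_substAlgHom hs, map_one, coe_substAlgHom hs, map_sub, map_one] at h
  exact sub_eq_zero.mp h

/-- By the `q`-binomial theorem the exponential splits as a product of two `q`-binomial series. -/
theorem expSeries_eq {b : K} (hb : b ≠ 0) (a ρ : K) :
    expSeries a b ρ = PowerSeries.map (HahnSeries.ofPowerSeries ℤ K)
      (rescale (C a) (qBinomialSeries b ρ) * qBinomialSeries b (-ρ)) := by
  obtain ⟨D, hD, hDc⟩ := exists_logDeriv_qBinomialSeries hb ρ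
  obtain ⟨D', hD', hDc'⟩ := exists_logDeriv_qBinomialSeries hb (-ρ)
  have hcc : constantCoeff (rescale (C a) (qBinomialSeries b ρ)) = 1 := by
    rw [← coeff_zero_eq_constantCoeff_apply, coeff_rescale]
    simp [constantCoeff_qBinomialSeries]
  have hexp : euler _ (exponent a b ρ) =
      PowerSeries.map (HahnSeries.ofPowerSeries ℤ K) (rescale (C a) D + D') := by
    have hinj : Function.Injective (HahnSeries.ofPowerSeries ℤ K) :=
      HahnSeries.ofPowerSeries_injective
    ext1 i
    rw [coeff_euler, PowerSeries.coeff_map, map_add, coeff_rescale]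
    rcases Nat.eq_zero_or_pos i with rfl | hi
    · have h0 : ∀ (E : K⟦X⟧⟦X⟧) (τ : K), euler _ (qBinomialSeries b τ) =
          E * qBinomialSeries b τ → coeff 0 E = 0 := by
        intro E τ hE
        have := congrArg (coeff 0) hE
        simpa [coeff_euler, constantCoeff_qBinomialSeries] using this.symm
      rw [h0 D ρ hD, h0 D' (-ρ) hD']
      simp
    · have hi0 : (i : K) ≠ 0 := by exact_mod_cast hi.ne'
      have hz := zetaSeries_ne_zero (mul_ne_zero hi0 (inv_ne_zero hb))
      have hz' : (HahnSeries.ofPowerSeries ℤ K) (zetaSeries (i * b⁻¹)) ≠ 0 :=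
        fun h => hz (hinj (by rw [h, map_zero]))
      have hsum : coeff i D' = - coeff i D := by
        apply mul_right_cancel₀ hz
        rw [hDc', neg_mul, hDc, mul_neg, zetaSeries_neg]
      have hratio : zetaRatio b ρ i = HahnSeries.ofPowerSeries ℤ K (coeff i D) := by
        rw [zetaRatio, div_eq_iff hz', ← map_mul, hDc]
      rw [hsum, exponent, coeff_mk, if_neg hi.ne', hratio]
      rw [show (i : K⸨X⸩) = HahnSeries.C (i : K) by simp, HahnSeries.C_mul_eq_smul, smul_smul,
        mul_div_cancel₀ _ hi0, ← HahnSeries.C_mul_eq_smul, ← HahnSeries.ofPowerSeries_C,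
        ← map_mul]
      congr 1
      rw [map_sub, map_pow, map_one]
      ring
  have := charZero_laurentSeries (K := K)
  apply eq_of_euler_eq_mul (g := euler _ (exponent a b ρ))
  · rw [← coeff_zero_eq_constantCoeff_apply, coeff_euler]
    simp
  · exact euler_expSeries a b ρ
  · rw [euler_map, hexp, ← map_mul, euler_mul, euler_rescale, hD, hD', map_mul]
    congr 1
    ring
  · rw [constantCoeff_expSeries, ← coeff_zero_eq_constantCoeff_apply, PowerSeries.coeff_map]
    simp [hcc, constantCoeff_qBinomialSeries]

/-- The coefficient of `w ^ m` in the exponential, as a power series in `u`. -/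
def wCoeff (a b ρ : K) (m : ℕ) : K⟦X⟧ :=
  ∑ sr ∈ Finset.HasAntidiagonal.antidiagonal m,
    C (a ^ sr.1 * (poch (ρ * b) sr.1 / (sr.1.factorial : K)) *
        (poch (-ρ * b) sr.2 / (sr.2.factorial : K))) *
      (qCorrection b ρ sr.1 * qCorrection b (-ρ) sr.2)

theorem coeff_expSeries {b : K} (hb : b ≠ 0) (a ρ : K) (m : ℕ) :
    coeff m (expSeries a b ρ) = HahnSeries.ofPowerSeries ℤ K (wCoeff a b ρ m) := by
  rw [expSeries_eq hb, PowerSeries.coeff_map, coeff_mul, wCoeff]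
  congr 1
  refine Finset.sum_congr rfl fun sr _ => ?_
  simp only [coeff_rescale, qBinomialSeries, coeff_mk, map_mul, map_pow]
  ring

theorem expCoeff_natCast {b : K} (hb : b ≠ 0) (a ρ : K) (n m : ℕ) :
    expCoeff a b ρ n m = coeff n (wCoeff a b ρ m) := by
  rw [expCoeff, coeff_expSeries hb, HahnSeries.ofPowerSeries_apply_coeff]

theorem expCoeff_of_neg {b : K} (hb : b ≠ 0) (a ρ : K) {n : ℤ} (hn : n < 0) (m : ℕ) :
    expCoeff a b ρ n m = 0 := by
  rw [expCoeff, coeff_expSeries hb, PowerSeries.coeff_coe, if_pos hn]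

/-- At `a = 1` the exponent vanishes, so all coefficients with `m ≥ 1` do. -/
theorem expCoeff_one (b ρ : K) (n : ℤ) {m : ℕ} (hm : 1 ≤ m) : expCoeff 1 b ρ n m = 0 := by
  have h0 : exponent 1 b ρ = 0 := by
    ext1 i
    simp [exponent]
  have h := congrArg (coeff m) (euler_expSeries 1 b ρ)
  rw [h0, map_zero, zero_mul, coeff_euler, map_zero] at h
  have := charZero_laurentSeries (K := K)
  have hm0 : (m : K⸨X⸩) ≠ 0 := by exact_mod_cast (by omega : m ≠ 0)
  rw [expCoeff, (mul_eq_zero.mp h).resolve_left hm0, HahnSeries.coeff_zero]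

theorem rescale_neg_one_sinhc : rescale (-1 : K) (sinhc K) = sinhc K := by
  ext n
  rw [coeff_rescale]
  rcases Nat.even_or_odd n with h | h
  · rw [h.neg_one_pow, one_mul]
  · rw [coeff_sinhc_of_odd h, mul_zero]

theorem rescale_neg_one_sinhc_inv : rescale (-1 : K) (sinhc K)⁻¹ = (sinhc K)⁻¹ := by
  have h := congrArg (rescale (-1 : K)) (sinhc_mul_inv (K := K))
  rw [map_mul, map_one, rescale_neg_one_sinhc] at h
  linear_combination (sinhc K)⁻¹ * h - rescale (-1 : K) (sinhc K)⁻¹ * sinhc_mul_inv (K := K)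

theorem rescale_neg_one_qCorrection (b ρ : K) (s : ℕ) :
    rescale (-1 : K) (qCorrection b ρ s) = qCorrection b ρ s := by
  simp only [qCorrection, map_prod, map_mul]
  refine Finset.prod_congr rfl fun j _ => ?_
  rw [rescale_rescale, rescale_rescale, mul_comm _ (-1), mul_comm _ (-1), ← rescale_rescale,
    ← rescale_rescale, rescale_neg_one_sinhc, rescale_neg_one_sinhc_inv]

theorem rescale_neg_one_wCoeff (a b ρ : K) (m : ℕ) :
    rescale (-1 : K) (wCoeff a b ρ m) = wCoeff a b ρ m := by
  simp only [wCoeff, map_sum, map_mul (rescale (-1 : K)), rescale_neg_one_qCorrection, rescale_C_eq]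

theorem expCoeff_of_odd {b : K} (hb : b ≠ 0) (a ρ : K) {n : ℕ} (hn : Odd n) (m : ℕ) :
    expCoeff a b ρ n m = 0 := by
  have h := congrArg (coeff n) (rescale_neg_one_wCoeff a b ρ m)
  rw [coeff_rescale, hn.neg_one_pow] at h
  rw [expCoeff_natCast hb]
  exact self_eq_neg.mp (by linear_combination -h)

end ExpSeries

/-! ### Polynomial functions of bounded degree -/

section PolynomialFunctions

variable {K σ Ω Ω' τ : Type*} [Field K]

/-- The functions on `Ω` that are polynomials of total degree at most `d` in the coordinate
functions `x i`. -/
def polyFun (x : σ → Ω → K) (d : ℕ) : Submodule K (Ω → K) :=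
  (MvPolynomial.restrictTotalDegree σ K d).map (MvPolynomial.aeval x).toLinearMap

theorem mem_polyFun {x : σ → Ω → K} {d : ℕ} {f : Ω → K} :
    f ∈ polyFun x d ↔ ∃ G : MvPolynomial σ K, G.totalDegree ≤ d ∧
      ∀ ω, f ω = MvPolynomial.eval (fun i => x i ω) G := by
  have key : ∀ (G : MvPolynomial σ K) (ω : Ω),
      MvPolynomial.aeval x G ω = MvPolynomial.eval (fun i => x i ω) G := by
    intro G ω
    have h : ((Pi.evalRingHom (fun _ : Ω => K) ω).comp
        (MvPolynomial.aeval x : MvPolynomial σ K →ₐ[K] Ω → K).toRingHom) =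
        MvPolynomial.eval (fun i => x i ω) := by
      apply MvPolynomial.ringHom_ext <;> intro i <;> simp
    exact congrArg (fun φ => φ G) h
  simp only [polyFun, Submodule.mem_map, MvPolynomial.mem_restrictTotalDegree]
  constructor
  · rintro ⟨G, hG, rfl⟩
    exact ⟨G, hG, fun ω => key G ω⟩
  · rintro ⟨G, hG, h⟩
    exact ⟨G, hG, funext fun ω => (key G ω).trans (h ω).symm⟩

theorem polyFun_mono {x : σ → Ω → K} {d e : ℕ} (h : d ≤ e) : polyFun x d ≤ polyFun x e := by
  intro f hf
  obtain ⟨G, hG, hf⟩ := mem_polyFun.mp hf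
  exact mem_polyFun.mpr ⟨G, hG.trans h, hf⟩

theorem mul_mem_polyFun {x : σ → Ω → K} {d e : ℕ} {f g : Ω → K} (hf : f ∈ polyFun x d)
    (hg : g ∈ polyFun x e) : f * g ∈ polyFun x (d + e) := by
  obtain ⟨F, hF, hf⟩ := mem_polyFun.mp hf
  obtain ⟨G, hG, hg⟩ := mem_polyFun.mp hg
  exact mem_polyFun.mpr ⟨F * G, (MvPolynomial.totalDegree_mul F G).trans (add_le_add hF hG),
    fun ω => by simp [hf, hg]⟩

theorem const_mem_polyFun (x : σ → Ω → K) (d : ℕ) (r : K) : (fun _ => r) ∈ polyFun x d :=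
  mem_polyFun.mpr ⟨MvPolynomial.C r, by simp, fun ω => by simp⟩

theorem coord_mem_polyFun (x : σ → Ω → K) (i : σ) : x i ∈ polyFun x 1 :=
  mem_polyFun.mpr ⟨MvPolynomial.X i, by simp, fun ω => by simp⟩

theorem mul_const_mem_polyFun {x : σ → Ω → K} {d : ℕ} {f : Ω → K} (hf : f ∈ polyFun x d)
    (r : K) : (fun ω => f ω * r) ∈ polyFun x d := by
  have h := Submodule.smul_mem _ r hf
  have heq : (fun ω => f ω * r) = r • f := by
    ext ω
    simp [mul_comm]
  rwa [heq]

theorem add_mem_polyFun {x : σ → Ω → K} {d : ℕ} {f g : Ω → K} (hf : f ∈ polyFun x d)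
    (hg : g ∈ polyFun x d) : (fun ω => f ω + g ω) ∈ polyFun x d :=
  Submodule.add_mem _ hf hg

theorem pow_mem_polyFun {x : σ → Ω → K} {d : ℕ} {f : Ω → K} (hf : f ∈ polyFun x d) (n : ℕ) :
    f ^ n ∈ polyFun x (n * d) := by
  induction n with
  | zero =>
    rw [pow_zero, zero_mul]
    exact const_mem_polyFun x 0 1
  | succ n ih =>
    rw [pow_succ, Nat.succ_mul]
    exact mul_mem_polyFun ih hf

theorem prod_mem_polyFun {ι : Type*} {x : σ → Ω → K} (s : Finset ι) {d : ι → ℕ}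
    {f : ι → Ω → K} (hf : ∀ i ∈ s, f i ∈ polyFun x (d i)) :
    ∏ i ∈ s, f i ∈ polyFun x (∑ i ∈ s, d i) := by
  classical
  induction s using Finset.induction_on with
  | empty => exact const_mem_polyFun x 0 1
  | insert i s hi ih =>
    rw [Finset.prod_insert hi, Finset.sum_insert hi]
    exact mul_mem_polyFun (hf i (Finset.mem_insert_self i s))
      (ih fun j hj => hf j (Finset.mem_insert_of_mem hj))

/-- To check that a subspace contains all polynomial functions of degree at most `d` it is enough
to look at monomials. -/
theorem polyFun_le [Fintype σ] {x : σ → Ω → K} {d : ℕ} {N : Submodule K (Ω → K)}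
    (h : ∀ e : σ → ℕ, ∑ i, e i ≤ d → ∏ i, x i ^ e i ∈ N) : polyFun x d ≤ N := by
  rw [polyFun, MvPolynomial.restrictTotalDegree, MvPolynomial.restrictSupport_eq_span,
    Submodule.map_span, Submodule.span_le]
  rintro _ ⟨_, ⟨e, he, rfl⟩, rfl⟩
  have h1 := h e (by simpa [Finsupp.sum_fintype] using he)
  simpa [MvPolynomial.aeval_monomial, Finsupp.prod_fintype] using h1

theorem comp_mem_polyFun [Fintype σ] {x : σ → Ω → K} {y : τ → Ω' → K} {d : ℕ} (φ : Ω' → Ω)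
    (hφ : ∀ i, x i ∘ φ ∈ polyFun y 1) {f : Ω → K} (hf : f ∈ polyFun x d) :
    f ∘ φ ∈ polyFun y d := by
  have hle : polyFun x d ≤ (polyFun y d).comap (LinearMap.funLeft K K φ) := by
    refine polyFun_le fun e he => ?_
    have h1 := prod_mem_polyFun (x := y) Finset.univ (f := fun i => (x i ∘ φ) ^ e i)
      (d := fun i => e i * 1) fun i _ => pow_mem_polyFun (hφ i) (e i)
    rw [Submodule.mem_comap]
    convert polyFun_mono (by simpa using he) h1 using 1
    ext ω
    simp [LinearMap.funLeft_apply]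
  exact hle hf

end PolynomialFunctions

/-! ### Polynomiality of the q-corrections -/

section Summation

variable {K : Type*} [Field K]

/-- The coordinates `ρ` and `s` on the set of pairs `(ρ, s)`. -/
def pairCoord (K : Type*) [Field K] : Fin 2 → K × ℕ → K :=
  ![fun ω => ω.1, fun ω => (ω.2 : K)]

theorem fst_mem_polyFun_pairCoord : (fun ω : K × ℕ => ω.1) ∈ polyFun (pairCoord K) 1 :=
  coord_mem_polyFun (pairCoord K) 0

theorem snd_mem_polyFun_pairCoord : (fun ω : K × ℕ => (ω.2 : K)) ∈ polyFun (pairCoord K) 1 :=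
  coord_mem_polyFun (pairCoord K) 1

variable [CharZero K]

/-- Faulhaber: summation over `s` raises the degree of a polynomial function by at most one. -/
theorem sum_range_mem_polyFun {d : ℕ} {f : K × ℕ → K} (hf : f ∈ polyFun (pairCoord K) d) :
    (fun ω : K × ℕ => ∑ j ∈ Finset.range ω.2, f (ω.1, j)) ∈ polyFun (pairCoord K) (d + 1) := by
  let L : (K × ℕ → K) →ₗ[K] (K × ℕ → K) :=
    { toFun := fun f ω => ∑ j ∈ Finset.range ω.2, f (ω.1, j)
      map_add' := fun f g => by ext ω; simp [Finset.sum_add_distrib]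
      map_smul' := fun r f => by ext ω; simp [Finset.mul_sum] }
  have hle : polyFun (pairCoord K) d ≤ (polyFun (pairCoord K) (d + 1)).comap L := by
    refine polyFun_le fun e he => ?_
    rw [Fin.sum_univ_two] at he
    rw [Submodule.mem_comap]
    have hterm : L (∏ i, pairCoord K i ^ e i) =
        ∑ i ∈ Finset.range (e 1 + 1),
          ((bernoulli i : ℚ) * ((e 1 + 1).choose i : K) / ((e 1 : K) + 1)) •
            ((fun ω : K × ℕ => ω.1) ^ e 0 * (fun ω : K × ℕ => (ω.2 : K)) ^ (e 1 + 1 - i)) := by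
      ext ω
      have hs := congrArg (Rat.cast : ℚ → K) (sum_range_pow ω.2 (e 1))
      push_cast at hs
      simp only [L, LinearMap.coe_mk, AddHom.coe_mk, Fin.prod_univ_two, pairCoord]
      simp only [Pi.mul_apply, Pi.pow_apply, Finset.sum_apply, Pi.smul_apply, smul_eq_mul,
        Matrix.cons_val_zero, Matrix.cons_val_one]
      rw [← Finset.mul_sum, hs, Finset.mul_sum]
      refine Finset.sum_congr rfl fun i _ => ?_
      ring
    rw [hterm]
    refine Submodule.sum_mem _ fun i _ => Submodule.smul_mem _ _ ?_
    refine polyFun_mono ?_ (mul_mem_polyFun (pow_mem_polyFun fst_mem_polyFun_pairCoord _)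
      (pow_mem_polyFun snd_mem_polyFun_pairCoord _))
    omega
  exact hle hf

theorem coeff_qCorrection_mem_polyFun (b : K) (n : ℕ) :
    (fun ω : K × ℕ => coeff n (qCorrection b ω.1 ω.2)) ∈ polyFun (pairCoord K) (2 * n) := by
  set f : K × ℕ → K⟦X⟧ := fun ω =>
    rescale (ω.1 + ω.2 * b⁻¹) (sinhc K) * rescale ((ω.2 + 1) * b⁻¹) (sinhc K)⁻¹ with hf
  have hfn : ∀ n, (fun ω => coeff n (f ω)) ∈ polyFun (pairCoord K) n := by
    intro n
    have h1 : (fun ω : K × ℕ => ω.1 + ω.2 * b⁻¹) ∈ polyFun (pairCoord K) 1 :=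
      add_mem_polyFun fst_mem_polyFun_pairCoord
        (mul_const_mem_polyFun snd_mem_polyFun_pairCoord b⁻¹)
    have h2 : (fun ω : K × ℕ => ((ω.2 : K) + 1) * b⁻¹) ∈ polyFun (pairCoord K) 1 :=
      mul_const_mem_polyFun (add_mem_polyFun snd_mem_polyFun_pairCoord
        (const_mem_polyFun _ 1 1)) b⁻¹
    have heq : (fun ω => coeff n (f ω)) = ∑ ij ∈ Finset.HasAntidiagonal.antidiagonal n,
        (coeff ij.1 (sinhc K) * coeff ij.2 (sinhc K)⁻¹) •
          ((fun ω : K × ℕ => ω.1 + ω.2 * b⁻¹) ^ ij.1 *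
            (fun ω : K × ℕ => ((ω.2 : K) + 1) * b⁻¹) ^ ij.2) := by
      ext ω
      simp only [hf, coeff_mul, coeff_rescale, Finset.sum_apply, Pi.smul_apply, Pi.mul_apply,
        Pi.pow_apply, smul_eq_mul]
      exact Finset.sum_congr rfl fun ij _ => by ring
    rw [heq]
    refine Submodule.sum_mem _ fun ij hij => Submodule.smul_mem _ _ ?_
    rw [Finset.HasAntidiagonal.mem_antidiagonal] at hij
    refine polyFun_mono ?_ (mul_mem_polyFun (pow_mem_polyFun h1 _) (pow_mem_polyFun h2 _))
    omega
  have hf0 : ∀ ω, coeff 0 (f ω) = 1 := by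
    intro ω
    simp only [hf, coeff_mul, coeff_rescale]
    simp [constantCoeff_sinhc]
  induction n using Nat.strong_induction_on with
  | _ n ih =>
    -- Sum the differences `P (s + 1) - P s = P s * (f s - 1)`, where `f s - 1` has no constant term.
    have hsum : (fun ω : K × ℕ => coeff n (qCorrection b ω.1 ω.2)) =
        (fun _ => coeff n (1 : K⟦X⟧)) + fun ω : K × ℕ => ∑ j ∈ Finset.range ω.2,
          coeff n (qCorrection b ω.1 j * (f (ω.1, j) - 1)) := by
      ext ⟨ρ, s⟩
      simp only [Pi.add_apply]
      induction s with
      | zero => simp [qCorrection]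
      | succ s ihs =>
        rw [Finset.sum_range_succ, ← add_assoc, ← ihs, ← map_add]
        congr 1
        rw [qCorrection, Finset.prod_range_succ, ← qCorrection]
        simp only [hf]
        ring
    rcases Nat.eq_zero_or_pos n with rfl | hn
    · have hone : (fun ω : K × ℕ => coeff 0 (qCorrection b ω.1 ω.2)) = fun _ => 1 := by
        rw [hsum]
        ext ω
        simp only [coeff_zero_eq_constantCoeff_apply] at hf0
        simp [hf0]
      rw [hone]
      exact const_mem_polyFun _ _ 1
    · rw [hsum]
      refine Submodule.add_mem _ (const_mem_polyFun _ _ _) ?_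
      have hdeg : 2 * n = 2 * n - 1 + 1 := by omega
      rw [hdeg]
      refine sum_range_mem_polyFun (f := fun ω =>
        coeff n (qCorrection b ω.1 ω.2 * (f ω - 1))) ?_
      have heq : (fun ω : K × ℕ => coeff n (qCorrection b ω.1 ω.2 * (f ω - 1))) =
          ∑ ij ∈ Finset.HasAntidiagonal.antidiagonal n,
            (fun ω : K × ℕ => coeff ij.1 (qCorrection b ω.1 ω.2)) *
              ((fun ω => coeff ij.2 (f ω)) - fun _ => coeff ij.2 1) := by
        ext ω
        simp [coeff_mul]
      rw [heq]
      refine Submodule.sum_mem _ fun ij hij => ?_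
      rw [Finset.HasAntidiagonal.mem_antidiagonal] at hij
      rcases Nat.eq_zero_or_pos ij.2 with h0 | h0
      · have hzero : ((fun ω => coeff ij.2 (f ω)) - fun _ => coeff ij.2 (1 : K⟦X⟧)) = 0 := by
          ext ω
          simp only [h0, Pi.sub_apply, hf0]
          simp
        rw [hzero, mul_zero]
        exact Submodule.zero_mem _
      · refine polyFun_mono ?_ (mul_mem_polyFun (ih ij.1 (by omega))
          (Submodule.sub_mem _ (hfn ij.2) (const_mem_polyFun _ _ _)))
        omega

end Summation

/-! ### The generating function of the Jacobi polynomials -/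

section Jacobi

variable {K : Type*} [Field K]

theorem poch_neg_natCast_mul_factorial {n s : ℕ} (hs : s ≤ n) :
    poch (-(n : K)) s * ((n - s).factorial : K) = (-1) ^ s * (n.factorial : K) := by
  induction s with
  | zero => simp [poch_zero]
  | succ s ih =>
    have h := ih (by omega)
    have hns : n - s = (n - (s + 1)) + 1 := by omega
    rw [hns, Nat.factorial_succ] at h
    have hcast : (((n - (s + 1)) + 1 : ℕ) : K) = (n : K) - s := by
      rw [← hns, Nat.cast_sub (by omega)]
    push_cast at h hcast
    rw [hcast] at h
    rw [poch_succ, pow_succ]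
    linear_combination -h

theorem poch_reflect (x : K) (n : ℕ) : poch (x - n) n = (-1) ^ n * poch (-x + 1) n := by
  induction n with
  | zero => simp [poch_zero]
  | succ n ih =>
    rw [poch_succ_left, poch_succ, pow_succ]
    have : x - ((n + 1 : ℕ) : K) + 1 = x - n := by push_cast; ring
    rw [this, ih]
    push_cast
    ring

variable [CharZero K]

/-- The binomial series `(1 - w)^{-x} = ∑ (x)_s w^s / s!`. -/
def negBinomial (x : K) : K⟦X⟧ :=
  PowerSeries.mk fun s => poch x s / (s.factorial : K)

theorem one_sub_X_mul_negBinomial (x : K) :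
    (1 - X) * negBinomial (x + 1) = negBinomial x := by
  ext n
  cases n with
  | zero => simp [negBinomial, poch_zero]
  | succ n =>
    have h1 : ((n : K) + 1) ≠ 0 := by exact_mod_cast Nat.succ_ne_zero n
    have h2 : (n.factorial : K) ≠ 0 := by exact_mod_cast Nat.factorial_ne_zero n
    rw [sub_mul, one_mul, map_sub, coeff_succ_X_mul]
    simp only [negBinomial, coeff_mk]
    rw [poch_succ, poch_succ_left x, Nat.factorial_succ]
    push_cast
    field_simp
    ring

theorem euler_negBinomial (x : K) :
    euler K (negBinomial x) = C x * (X * negBinomial (x + 1)) := by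
  ext n
  rw [coeff_euler, coeff_C_mul]
  cases n with
  | zero => simp
  | succ n =>
    have h1 : ((n : K) + 1) ≠ 0 := by exact_mod_cast Nat.succ_ne_zero n
    have h2 : (n.factorial : K) ≠ 0 := by exact_mod_cast Nat.factorial_ne_zero n
    rw [coeff_succ_X_mul]
    simp only [negBinomial, coeff_mk]
    rw [poch_succ_left x, Nat.factorial_succ]
    push_cast
    field_simp

/-- The series `(1 - a w)^{-c - 1} (1 - w)^{c - 1}`, the generating function of the Jacobi
polynomials `(-1)^n P_n^{(c - n - 1, 1)}(1 - 2 a)`. -/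
def jacobiSeries (a c : K) : K⟦X⟧ :=
  rescale a (negBinomial (c + 1)) * negBinomial (-c + 1)

theorem specJacobi_natCast (a b ρ : K) (n : ℕ) :
    specJacobi a b ρ n = (-1) ^ n * coeff n (jacobiSeries a (ρ * b)) := by
  rw [specJacobi, jacobiZ, if_pos (Int.natCast_nonneg n), Int.toNat_natCast, jacobi, jacobiSeries,
    coeff_mul, Finset.Nat.sum_antidiagonal_eq_sum_range_succ_mk, Finset.mul_sum]
  refine Finset.sum_congr rfl fun s hs => ?_
  have hsn : s ≤ n := Nat.lt_succ_iff.mp (Finset.mem_range.mp hs)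
  have h1 := poch_neg_natCast_mul_factorial (K := K) hsn
  have h2 := poch_reflect (ρ * b) (n - s)
  have h3 : (ρ * b - ((n : ℤ) : K) - 1 + s + 1) = ρ * b - ((n - s : ℕ) : K) := by
    rw [Nat.cast_sub hsn]; push_cast; ring
  have h4 : 1 + (ρ * b - ((n : ℤ) : K) - 1) + 1 + n = ρ * b + 1 := by push_cast; ring
  have h5 : (1 - (1 - 2 * a)) / 2 = a := by ring
  have hf : (n.factorial : K) ≠ 0 := by exact_mod_cast Nat.factorial_ne_zero n
  have hfs : (s.factorial : K) ≠ 0 := by exact_mod_cast Nat.factorial_ne_zero s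
  have hfr : ((n - s).factorial : K) ≠ 0 := by exact_mod_cast Nat.factorial_ne_zero (n - s)
  have hp : poch (-(n : K)) s = (-1) ^ s * (n.factorial : K) / ((n - s).factorial : K) :=
    eq_div_of_mul_eq hfr h1
  have hsign : ((-1 : K)) ^ n = (-1) ^ (n - s) * (-1) ^ s := by
    rw [← pow_add, Nat.sub_add_cancel hsn]
  rw [h3, h4, h5, h2, hp, hsign]
  simp only [coeff_rescale, negBinomial, coeff_mk]
  field_simp

theorem specJacobi_sub_one (a b ρ : K) (m : ℕ) :
    specJacobi a b ρ ((m : ℤ) - 1) =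
      -(-1) ^ m * coeff m (X * jacobiSeries a (ρ * b)) := by
  cases m with
  | zero => simp [specJacobi, jacobiZ]
  | succ m =>
    rw [coeff_succ_X_mul, show ((m + 1 : ℕ) : ℤ) - 1 = (m : ℤ) by push_cast; ring,
      specJacobi_natCast, pow_succ]
    ring

theorem specJacobi_sub_two (a b ρ : K) (m : ℕ) :
    specJacobi a b ρ ((m : ℤ) - 2) =
      (-1) ^ m * coeff m (X * (X * jacobiSeries a (ρ * b))) := by
  cases m with
  | zero => simp [specJacobi, jacobiZ]
  | succ m =>
    rw [coeff_succ_X_mul, show ((m + 1 : ℕ) : ℤ) - 2 = (m : ℤ) - 1 by push_cast; ring,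
      specJacobi_sub_one, pow_succ]
    ring

end Jacobi

/-! ### Reduction of moments to two Jacobi polynomials -/

section Moments

variable {K : Type*} [Field K]

/-- The term `a^s (c)_s / s! * (-c)_r / r!` of the coefficient of `w^(s + r)` in
`((1 - w) / (1 - a w))^c`. -/
def hyperTerm (a c : K) (sr : ℕ × ℕ) : K :=
  a ^ sr.1 * (poch c sr.1 / (sr.1.factorial : K)) * (poch (-c) sr.2 / (sr.2.factorial : K))

/-- The coordinates `ρ`, `s` and `m = s + r` on the set of triples `(ρ, s, r)`. -/
def tripleCoord (K : Type*) [Field K] : Fin 3 → K × ℕ × ℕ → K :=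
  ![fun ω => ω.1, fun ω => (ω.2.1 : K), fun ω => (ω.2.1 : K) + ω.2.2]

/-- `m` times the sum over `s + r = m` of a function of `(ρ, s, r)` against the terms of the
coefficient of `w^m` in `((1 - w) / (1 - a w))^{ρ b}`. The factor `m` avoids the division in
`ρ / m`, so that all identities also hold at `m = 0`. -/
def moment (a b : K) : (K × ℕ × ℕ → K) →ₗ[K] (K × ℕ → K) where
  toFun h ω := ω.2 * ∑ sr ∈ Finset.HasAntidiagonal.antidiagonal ω.2,
    hyperTerm a (ω.1 * b) sr * h (ω.1, sr)
  map_add' f g := by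
    ext ω
    simp [mul_add, Finset.sum_add_distrib]
  map_smul' r f := by
    ext ω
    simp only [Pi.smul_apply, smul_eq_mul, RingHom.id_apply, Finset.mul_sum]
    exact Finset.sum_congr rfl fun _ _ => by ring

theorem moment_apply (a b : K) (h : K × ℕ × ℕ → K) (ω : K × ℕ) :
    moment a b h ω = ω.2 * ∑ sr ∈ Finset.HasAntidiagonal.antidiagonal ω.2,
      hyperTerm a (ω.1 * b) sr * h (ω.1, sr) := rfl

/-- The functions `ρ (g₁ A_{m-1} + g₂ A_{m-2})` of `(ρ, m)` with `g₁`, `g₂` polynomial of degree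
at most `d`, where `A_n` is the coefficient of `w^n` in `jacobiSeries a (ρ b)` and `A_n = 0` for
negative `n`. -/
def jacobiSpan (a b : K) (d : ℕ) : Submodule K (K × ℕ → K) :=
  (polyFun (pairCoord K) d).map (LinearMap.mulLeft K fun ω : K × ℕ =>
      ω.1 * coeff ω.2 (X * jacobiSeries a (ω.1 * b))) ⊔
    (polyFun (pairCoord K) d).map (LinearMap.mulLeft K fun ω : K × ℕ =>
      ω.1 * coeff ω.2 (X * (X * jacobiSeries a (ω.1 * b))))

theorem mem_jacobiSpan {a b : K} {d : ℕ} {f : K × ℕ → K} :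
    f ∈ jacobiSpan a b d ↔ ∃ g₁ ∈ polyFun (pairCoord K) d, ∃ g₂ ∈ polyFun (pairCoord K) d,
      ∀ ω : K × ℕ, f ω = ω.1 * (g₁ ω * coeff ω.2 (X * jacobiSeries a (ω.1 * b)) +
        g₂ ω * coeff ω.2 (X * (X * jacobiSeries a (ω.1 * b)))) := by
  rw [jacobiSpan, Submodule.mem_sup]
  constructor
  · rintro ⟨_, ⟨g₁, hg₁, rfl⟩, _, ⟨g₂, hg₂, rfl⟩, rfl⟩
    refine ⟨g₁, hg₁, g₂, hg₂, fun ω => ?_⟩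
    simp only [LinearMap.mulLeft_apply, Pi.add_apply, Pi.mul_apply]
    ring
  · rintro ⟨g₁, hg₁, g₂, hg₂, h⟩
    refine ⟨_, ⟨g₁, hg₁, rfl⟩, _, ⟨g₂, hg₂, rfl⟩, ?_⟩
    ext ω
    simp only [LinearMap.mulLeft_apply, Pi.add_apply, Pi.mul_apply, h]
    ring

theorem mul_mem_jacobiSpan {a b : K} {d e n : ℕ} {f g : K × ℕ → K}
    (hg : g ∈ polyFun (pairCoord K) e) (hf : f ∈ jacobiSpan a b d) (hn : e + d ≤ n) :
    g * f ∈ jacobiSpan a b n := by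
  obtain ⟨g₁, hg₁, g₂, hg₂, h⟩ := mem_jacobiSpan.mp hf
  refine mem_jacobiSpan.mpr ⟨g * g₁, polyFun_mono hn (mul_mem_polyFun hg hg₁), g * g₂,
    polyFun_mono hn (mul_mem_polyFun hg hg₂), fun ω => ?_⟩
  simp only [Pi.mul_apply, h]
  ring

/-- The function `s ^ j` of `(ρ, s, r)`. -/
def sPow (K : Type*) [Field K] (j : ℕ) : K × ℕ × ℕ → K := fun ω => (ω.2.1 : K) ^ j

variable [CharZero K]

/-- The zeroth moment, from `w F' = c (a - 1) w A` for `F = ((1 - w) / (1 - a w))^c` and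
`A = jacobiSeries a c`. -/
theorem sum_hyperTerm (a c : K) (m : ℕ) :
    (m : K) * ∑ sr ∈ Finset.HasAntidiagonal.antidiagonal m, hyperTerm a c sr =
      c * (a - 1) * coeff m (X * jacobiSeries a c) := by
  have h1 : rescale a (negBinomial c) = (1 - C a * X) * rescale a (negBinomial (c + 1)) := by
    rw [← one_sub_X_mul_negBinomial c, map_mul, map_sub, map_one, rescale_X]
  have h2 := one_sub_X_mul_negBinomial (-c)
  have heuler : euler K (rescale a (negBinomial c) * negBinomial (-c)) =
      C (c * (a - 1)) * (X * jacobiSeries a c) := by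
    rw [euler_mul, euler_rescale, euler_negBinomial, euler_negBinomial, h1, ← h2, jacobiSeries]
    simp only [map_mul, rescale_X, rescale_C_eq, map_neg, map_sub, map_one]
    ring
  have h := congrArg (coeff m) heuler
  rw [coeff_euler, coeff_C_mul, coeff_mul] at h
  rw [← h]
  simp [coeff_rescale, negBinomial, hyperTerm]

/-- The first moment, from applying `w d/dw` only to the factor `(1 - a w)^{-c}`. -/
theorem sum_hyperTerm_mul_fst (a c : K) (m : ℕ) :
    ∑ sr ∈ Finset.HasAntidiagonal.antidiagonal m, hyperTerm a c sr * sr.1 =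
      c * a * (coeff m (X * jacobiSeries a c) - coeff m (X * (X * jacobiSeries a c))) := by
  have h2 := one_sub_X_mul_negBinomial (-c)
  have heuler : euler K (rescale a (negBinomial c)) * negBinomial (-c) =
      C (c * a) * (X * jacobiSeries a c - X * (X * jacobiSeries a c)) := by
    rw [euler_rescale, euler_negBinomial, ← h2, jacobiSeries]
    simp only [map_mul, rescale_X, rescale_C_eq]
    ring
  have h := congrArg (coeff m) heuler
  rw [coeff_C_mul, map_sub, coeff_mul] at h
  rw [← h]
  refine Finset.sum_congr rfl fun sr _ => ?_
  simp only [coeff_euler, coeff_rescale, negBinomial, hyperTerm, coeff_mk]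
  ring

theorem moment_sPow_zero_mem (a b : K) : moment a b (sPow K 0) ∈ jacobiSpan a b 0 := by
  refine mem_jacobiSpan.mpr ⟨_, const_mem_polyFun _ _ (b * (a - 1)), _,
    const_mem_polyFun _ _ 0, fun ω => ?_⟩
  have h := sum_hyperTerm a (ω.1 * b) ω.2
  simp only [moment_apply, sPow, pow_zero, mul_one, h]
  ring

theorem moment_sPow_one_mem (a b : K) : moment a b (sPow K 1) ∈ jacobiSpan a b 1 := by
  refine mem_jacobiSpan.mpr ⟨_, mul_const_mem_polyFun snd_mem_polyFun_pairCoord (b * a), _,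
    mul_const_mem_polyFun snd_mem_polyFun_pairCoord (-(b * a)), fun ω => ?_⟩
  have h := sum_hyperTerm_mul_fst a (ω.1 * b) ω.2
  simp only [moment_apply, sPow, pow_one, h]
  ring

/-- The recurrence for the terms of a `₂F₁`, summed against a test function. -/
theorem sum_hyperTerm_shift (a c : K) (m : ℕ) (g : ℕ → K) :
    ∑ sr ∈ Finset.HasAntidiagonal.antidiagonal m, hyperTerm a c sr * (sr.1 * (sr.2 - c) * g sr.1) =
      a * ∑ sr ∈ Finset.HasAntidiagonal.antidiagonal m,
        hyperTerm a c sr * ((c + sr.1) * sr.2 * g (sr.1 + 1)) := by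
  cases m with
  | zero => simp
  | succ m =>
    rw [Finset.Nat.sum_antidiagonal_succ, Finset.Nat.sum_antidiagonal_succ']
    simp only [Nat.cast_zero, zero_mul, mul_zero, zero_add]
    rw [Finset.mul_sum]
    refine Finset.sum_congr rfl fun sr _ => ?_
    have h1 : ((sr.1 : K) + 1) ≠ 0 := by exact_mod_cast Nat.succ_ne_zero sr.1
    have h2 : ((sr.2 : K) + 1) ≠ 0 := by exact_mod_cast Nat.succ_ne_zero sr.2
    have h3 : (sr.1.factorial : K) ≠ 0 := by exact_mod_cast Nat.factorial_ne_zero sr.1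
    have h4 : (sr.2.factorial : K) ≠ 0 := by exact_mod_cast Nat.factorial_ne_zero sr.2
    simp only [hyperTerm, poch_succ, Nat.factorial_succ]
    push_cast
    field_simp
    ring

/-- The reduction of moments, from the recurrence of the terms with test function `s ^ d`, in which
the top power of `(s + 1) ^ d` is split off. It lowers the exponent of `s` at the price of
coefficients that are polynomial in `ρ` and `m`; the leading coefficient `1 - a` is constant. -/
theorem moment_sPow_add_two (a b : K) (d : ℕ) (ω : K × ℕ) :
    (1 - a) * moment a b (sPow K (d + 2)) ω =
      (ω.2 - ω.1 * b) * moment a b (sPow K (d + 1)) ω -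
        a * (ω.1 * b * ω.2 * moment a b (sPow K d) ω +
          (ω.2 - ω.1 * b) * moment a b (sPow K (d + 1)) ω +
          ∑ i ∈ Finset.range d, (d.choose i : K) *
            (ω.1 * b * ω.2 * moment a b (sPow K i) ω +
              (ω.2 - ω.1 * b) * moment a b (sPow K (i + 1)) ω -
              moment a b (sPow K (i + 2)) ω)) := by
  obtain ⟨ρ, m⟩ := ω
  simp only [moment_apply, sPow]
  set c := ρ * b
  set A := Finset.HasAntidiagonal.antidiagonal m
  set S : ℕ → K := fun j => ∑ sr ∈ A, hyperTerm a c sr * (sr.1 : K) ^ j with hS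
  have hshift := sum_hyperTerm_shift a c m fun s => (s : K) ^ d
  have hr : ∀ sr ∈ A, (sr.2 : K) = m - sr.1 := by
    intro sr hsr
    rw [← Finset.HasAntidiagonal.mem_antidiagonal.mp hsr]
    push_cast
    ring
  have hleft : ∑ sr ∈ A, hyperTerm a c sr * (sr.1 * (sr.2 - c) * (sr.1 : K) ^ d) =
      (m - c) * S (d + 1) - S (d + 2) := by
    simp only [hS, Finset.mul_sum]
    rw [← Finset.sum_sub_distrib]
    refine Finset.sum_congr rfl fun sr hsr => ?_
    rw [hr sr hsr]
    ring
  have hright : ∑ sr ∈ A, hyperTerm a c sr *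
        ((c + sr.1) * sr.2 * ((sr.1 + 1 : ℕ) : K) ^ d) =
      ∑ i ∈ Finset.range (d + 1), (d.choose i : K) *
        (c * m * S i + (m - c) * S (i + 1) - S (i + 2)) := by
    simp only [hS, Finset.mul_sum, ← Finset.sum_add_distrib, ← Finset.sum_sub_distrib]
    rw [Finset.sum_comm]
    refine Finset.sum_congr rfl fun sr hsr => ?_
    rw [hr sr hsr, Nat.cast_add, Nat.cast_one, add_pow, Finset.mul_sum, Finset.mul_sum]
    refine Finset.sum_congr rfl fun i _ => ?_
    rw [one_pow]
    ring
  rw [hleft, hright, Finset.sum_range_succ, Nat.choose_self] at hshift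
  have hmul : ∑ i ∈ Finset.range d, (d.choose i : K) * (c * m * (m * S i) +
        (m - c) * (m * S (i + 1)) - m * S (i + 2)) =
      m * ∑ i ∈ Finset.range d, (d.choose i : K) *
        (c * m * S i + (m - c) * S (i + 1) - S (i + 2)) := by
    rw [Finset.mul_sum]
    exact Finset.sum_congr rfl fun i _ => by ring
  rw [hmul]
  push_cast at hshift
  linear_combination (-(m : K)) * hshift

theorem moment_sPow_mem {a : K} (ha : a ≠ 1) (b : K) (j : ℕ) :
    moment a b (sPow K j) ∈ jacobiSpan a b j := by
  induction j using Nat.strong_induction_on with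
  | _ j ih =>
    match j, ih with
    | 0, _ => exact moment_sPow_zero_mem a b
    | 1, _ => exact moment_sPow_one_mem a b
    | d + 2, ih =>
      have ha' : 1 - a ≠ 0 := sub_ne_zero.mpr ha.symm
      have hprod := mul_mem_polyFun (mul_const_mem_polyFun fst_mem_polyFun_pairCoord b)
        (snd_mem_polyFun_pairCoord (K := K))
      have hcm : (fun ω : K × ℕ => ω.1 * b * ω.2) ∈ polyFun (pairCoord K) 2 :=
        hprod
      have hmc : (fun ω : K × ℕ => (ω.2 : K) - ω.1 * b) ∈ polyFun (pairCoord K) 1 :=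
        Submodule.sub_mem _ snd_mem_polyFun_pairCoord
          (mul_const_mem_polyFun fst_mem_polyFun_pairCoord b)
      have heq : moment a b (sPow K (d + 2)) = (1 - a)⁻¹ •
          ((fun ω : K × ℕ => (ω.2 : K) - ω.1 * b) * moment a b (sPow K (d + 1)) -
            a • ((fun ω : K × ℕ => ω.1 * b * ω.2) * moment a b (sPow K d) +
              (fun ω : K × ℕ => (ω.2 : K) - ω.1 * b) * moment a b (sPow K (d + 1)) +
              ∑ i ∈ Finset.range d, (d.choose i : K) •
                ((fun ω : K × ℕ => ω.1 * b * ω.2) * moment a b (sPow K i) +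
                  (fun ω : K × ℕ => (ω.2 : K) - ω.1 * b) * moment a b (sPow K (i + 1)) -
                  moment a b (sPow K (i + 2))))) := by
        ext ω
        simp only [Pi.smul_apply, Pi.sub_apply, Pi.add_apply, Pi.mul_apply, Finset.sum_apply,
          smul_eq_mul]
        rw [← moment_sPow_add_two, inv_mul_cancel_left₀ ha']
      have h1 : (fun ω : K × ℕ => (ω.2 : K) - ω.1 * b) * moment a b (sPow K (d + 1)) ∈
          jacobiSpan a b (d + 2) :=
        mul_mem_jacobiSpan hmc (ih (d + 1) (by omega)) (by omega)
      rw [heq]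
      refine Submodule.smul_mem _ _ (Submodule.sub_mem _ h1 (Submodule.smul_mem _ _
        (Submodule.add_mem _ (Submodule.add_mem _ ?_ h1)
          (Submodule.sum_mem _ fun i hi => Submodule.smul_mem _ _ ?_))))
      · exact mul_mem_jacobiSpan hcm (ih d (by omega)) (by omega)
      · have hid := Finset.mem_range.mp hi
        refine Submodule.sub_mem _ (Submodule.add_mem _
          (mul_mem_jacobiSpan hcm (ih i (by omega)) (by omega))
          (mul_mem_jacobiSpan hmc (ih (i + 1) (by omega)) (by omega))) ?_
        have h2 := mul_mem_jacobiSpan (n := d + 2) (const_mem_polyFun _ 0 1)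
          (ih (i + 2) (by omega)) (by omega)
        have h3 : (fun _ : K × ℕ => (1 : K)) * moment a b (sPow K (i + 2)) =
          moment a b (sPow K (i + 2)) := one_mul _
        rwa [h3] at h2

theorem moment_mem {a : K} (ha : a ≠ 1) (b : K) {d : ℕ} {h : K × ℕ × ℕ → K}
    (hh : h ∈ polyFun (tripleCoord K) d) : moment a b h ∈ jacobiSpan a b d := by
  have hle : polyFun (tripleCoord K) d ≤ (jacobiSpan a b d).comap (moment a b) := by
    refine polyFun_le fun e he => ?_
    rw [Fin.sum_univ_three] at he
    rw [Submodule.mem_comap]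
    have heq : moment a b (∏ i, tripleCoord K i ^ e i) =
        ((fun ω : K × ℕ => ω.1) ^ e 0 * (fun ω : K × ℕ => (ω.2 : K)) ^ e 2) *
          moment a b (sPow K (e 1)) := by
      ext ⟨ρ, m⟩
      simp only [moment_apply, Pi.mul_apply, Pi.pow_apply, Finset.mul_sum]
      refine Finset.sum_congr rfl fun sr hsr => ?_
      rw [← Finset.HasAntidiagonal.mem_antidiagonal.mp hsr]
      simp only [Fin.prod_univ_three, tripleCoord, sPow, Pi.mul_apply, Pi.pow_apply,
        Matrix.cons_val_zero, Matrix.cons_val_one, Matrix.cons_val]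
      push_cast
      ring
    rw [heq]
    refine mul_mem_jacobiSpan (mul_mem_polyFun (pow_mem_polyFun fst_mem_polyFun_pairCoord _)
      (pow_mem_polyFun snd_mem_polyFun_pairCoord _)) (moment_sPow_mem ha b (e 1)) ?_
    omega
  exact hle hh

/-- The correction factors contribute to `[u^n]` a polynomial in `ρ`, `s`, `m`. -/
theorem coeff_qCorrection_mul_mem_polyFun (b : K) (n : ℕ) :
    (fun ω : K × ℕ × ℕ =>
      coeff n (qCorrection b ω.1 ω.2.1 * qCorrection b (-ω.1) ω.2.2)) ∈
        polyFun (tripleCoord K) (2 * n) := by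
  have h0 : (fun ω : K × ℕ × ℕ => ω.1) ∈ polyFun (tripleCoord K) 1 :=
    coord_mem_polyFun (tripleCoord K) 0
  have h1 : (fun ω : K × ℕ × ℕ => (ω.2.1 : K)) ∈ polyFun (tripleCoord K) 1 :=
    coord_mem_polyFun (tripleCoord K) 1
  have h2 : (fun ω : K × ℕ × ℕ => (ω.2.1 : K) + ω.2.2) ∈ polyFun (tripleCoord K) 1 :=
    coord_mem_polyFun (tripleCoord K) 2
  have h3 : (fun ω : K × ℕ × ℕ => (ω.2.2 : K)) ∈ polyFun (tripleCoord K) 1 := by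
    have heq : (fun ω : K × ℕ × ℕ => (ω.2.2 : K)) =
        (fun ω : K × ℕ × ℕ => (ω.2.1 : K) + ω.2.2) - fun ω => (ω.2.1 : K) := by
      ext ω
      simp
    rw [heq]
    exact Submodule.sub_mem _ h2 h1
  have heq : (fun ω : K × ℕ × ℕ =>
      coeff n (qCorrection b ω.1 ω.2.1 * qCorrection b (-ω.1) ω.2.2)) =
      ∑ ij ∈ Finset.HasAntidiagonal.antidiagonal n,
        ((fun ω : K × ℕ => coeff ij.1 (qCorrection b ω.1 ω.2)) ∘
            fun ω : K × ℕ × ℕ => (ω.1, ω.2.1)) *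
          ((fun ω : K × ℕ => coeff ij.2 (qCorrection b ω.1 ω.2)) ∘
            fun ω : K × ℕ × ℕ => (-ω.1, ω.2.2)) := by
    ext ω
    simp [coeff_mul]
  rw [heq]
  refine Submodule.sum_mem _ fun ij hij => ?_
  rw [Finset.HasAntidiagonal.mem_antidiagonal] at hij
  refine polyFun_mono ?_ (mul_mem_polyFun
    (comp_mem_polyFun _ ?_ (coeff_qCorrection_mem_polyFun b ij.1))
    (comp_mem_polyFun _ ?_ (coeff_qCorrection_mem_polyFun b ij.2)))
  · omega
  · intro i
    fin_cases i
    · exact h0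
    · exact h1
  · intro i
    fin_cases i
    · exact Submodule.neg_mem _ h0
    · exact h3

theorem natCast_mul_expCoeff {b : K} (hb : b ≠ 0) (a ρ : K) (n m : ℕ) :
    (m : K) * expCoeff a b ρ n m = moment a b (fun ω : K × ℕ × ℕ =>
      coeff n (qCorrection b ω.1 ω.2.1 * qCorrection b (-ω.1) ω.2.2)) (ρ, m) := by
  rw [expCoeff_natCast hb, wCoeff, moment_apply, map_sum]
  simp only [coeff_C_mul, hyperTerm, neg_mul]

end Moments

end TorusKnot

end

theorem proposition5p3 {K : Type*} [Field K] [CharZero K] (a b : K) (hb : b ≠ 0) :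
    (∀ k : ℕ, ∃ G₁ G₂ : MvPolynomial (Fin 2) K,
      G₁.totalDegree ≤ 9 * k + 2 ∧ G₂.totalDegree ≤ 9 * k + 2 ∧
      ∀ m : ℕ, 1 ≤ m → ∀ ρ : K,
        TorusKnot.expCoeff a b ρ (2 * (k : ℤ)) m =
          (-1) ^ m * (ρ / (m : K)) *
            (MvPolynomial.eval ![ρ, (m : K)] G₁ * TorusKnot.specJacobi a b ρ ((m : ℤ) - 1) +
              MvPolynomial.eval ![ρ, (m : K)] G₂ * TorusKnot.specJacobi a b ρ ((m : ℤ) - 2))) ∧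
    (∀ (m : ℕ) (ρ : K) (n : ℤ), (Odd n ∨ n < 0) → TorusKnot.expCoeff a b ρ n m = 0) := by
  open TorusKnot in
  refine ⟨fun k => ?_, fun m ρ n hn => ?_⟩
  · -- The moment reduction divides by `1 - a`; at `a = 1` the left-hand side is zero.
    by_cases ha : a = 1
    · subst ha
      exact ⟨0, 0, by simp, by simp, fun m hm ρ => by simp [expCoeff_one b ρ _ hm]⟩
    · obtain ⟨g₁, hg₁, g₂, hg₂, h⟩ := mem_jacobiSpan.mp
        (moment_mem ha b (coeff_qCorrection_mul_mem_polyFun b (2 * k)))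
      obtain ⟨G₁, hG₁, he₁⟩ := mem_polyFun.mp hg₁
      obtain ⟨G₂, hG₂, he₂⟩ := mem_polyFun.mp hg₂
      -- The sign of `J_{m-1}` is opposite to `(-1)^m`, that of `J_{m-2}` agrees with it.
      refine ⟨-G₁, G₂, by rw [MvPolynomial.totalDegree_neg]; omega, by omega, fun m hm ρ => ?_⟩
      have hm0 : (m : K) ≠ 0 := by exact_mod_cast (by omega : m ≠ 0)
      have hx : (fun i => pairCoord K i (ρ, m)) = ![ρ, (m : K)] := by
        ext i
        fin_cases i <;> rfl
      have h1 := h (ρ, m)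
      rw [← natCast_mul_expCoeff hb, he₁, he₂, hx] at h1
      have hk : ((2 * k : ℕ) : ℤ) = 2 * (k : ℤ) := by push_cast; ring
      rw [hk] at h1
      have hsq : ((-1 : K) ^ m) * (-1) ^ m = 1 := by
        rw [← mul_pow]
        simp
      apply mul_left_cancel₀ hm0
      rw [h1, specJacobi_sub_one, specJacobi_sub_two, map_neg]
      field_simp
      linear_combination (-ρ * (MvPolynomial.eval ![ρ, (m : K)] G₁ *
        PowerSeries.coeff m (PowerSeries.X * jacobiSeries a (ρ * b)) +
        MvPolynomial.eval ![ρ, (m : K)] G₂ *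
        PowerSeries.coeff m (PowerSeries.X * (PowerSeries.X * jacobiSeries a (ρ * b))))) * hsq
  · rcases lt_or_ge n 0 with h | h
    · exact expCoeff_of_neg hb a ρ h m
    · lift n to ℕ using h
      have hodd : Odd n := by
        rcases hn with hn | hn
        · exact_mod_cast hn
        · omega
      exact expCoeff_of_odd hb a ρ hodd m
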